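/- A hypergraph is a finite bipartite graph $H$ with a fixed bipartition $V\cup E$; elements of $V$ are hypervertices, elements of $E$ are hyperedges, $v\in V$ is incident to $e\in E$ if they are adjacent, and $N_H(u)$ denotes the set of neighbours of $u$. A path or cycle of $H$ is strong if the subgraph of $H$ induced on its vertex set has no edges other than those of the path or cycle. $H$ is balanced if it has no strong cycle of length $4k+2$ with an integer $k\ge 1$. A matching of $H$ is a set $M\subseteq E$ such that every hypervertex is incident to at most one element of $M$; it covers $U\subseteq V$ if every element of $U$ is incident to at least one element of $M$. A set $U\subseteq V$ is an independent transversal if every hyperedge is incident to exactly one element of $U$. Let $H$ be a balanced hypergraph and let $U$ be an independent transversal of $H$. Let $H'$ be the hypergraph obtained from $H$ by adding two hypervertices $v_0,v_1$, a hyperedge $e_0$ with $N_{H'}(e_0)=\{v_0,v_1\}$, and for each $u\in U$ a hyperedge $f_u$ with $N_{H'}(f_u)=\{v_1,u\}$. In the game $\mathcal G(H',v_0)$ a play is a strong path $P=v_0e_0x_1g_1\ldots x_kg_k$ of $H'$ (with hypervertices $x_i$ and hyperedges $g_i$). The game starts with $P=v_0e_0$; Players 1 and 2 move alternately, Player 1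 first; the player to move chooses a hypervertex $x$ and a hyperedge $g$ such that $Pxg$ is again a strong path of $H'$, and replaces $P$ by $Pxg$. A player who is unable to move loses. **Theorem 4.** $H$ has a matching covering $U$ if and only if Player 2 has a winning strategy in $\mathcal G(H',v_0)$. -/

import Mathlib

/-- A hypergraph with hypervertices `V` and hyperedges `E`, given by its incidence relation.
Distinct hyperedges may have the same incident hypervertices, and there may be hyperedges or
hypervertices incident to nothing. -/
structure IncHypergraph (V E : Type*) where
  /-- `Inc v e` : the hypervertex `v` is incident to the hyperedge `e`. -/
  Inc : V → E → Prop

/-- A walk `z₁ z₂ … zₖ` of a graph is *strong* if the subgraph induced on its support contains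
exactly the edges `zᵢ zᵢ₊₁`. (That it contains these edges is part of being a walk.) -/
def SimpleGraph.Walk.IsStrong {W : Type*} {G : SimpleGraph W} {a b : W} (p : G.Walk a b) : Prop :=
  ∀ x ∈ p.support, ∀ y ∈ p.support, G.Adj x y → s(x, y) ∈ p.edges

namespace IncHypergraph

variable {V E : Type*}

/-- The bipartite incidence graph of a hypergraph, with bipartition `V`, `E`. -/
def graph (H : IncHypergraph V E) : SimpleGraph (V ⊕ E) where
  Adj
    | .inl v, .inr e => H.Inc v e
    | .inr e, .inl v => H.Inc v e
    | .inl _, .inl _ => False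
    | .inr _, .inr _ => False
  symm := ⟨by rintro (a | a) (b | b) h <;> exact h⟩
  loopless := ⟨by rintro (a | a) h <;> exact h⟩

/-- `S` covers `T`: every element of `T` has at least one neighbour in `S`. -/
def Covers (H : IncHypergraph V E) (S T : Set (V ⊕ E)) : Prop :=
  ∀ u ∈ T, 1 ≤ (H.graph.neighborSet u ∩ S).encard

/-- `S` splits `T`: every element of `T` has at most one neighbour in `S`. -/
def Splits (H : IncHypergraph V E) (S T : Set (V ⊕ E)) : Prop :=
  ∀ u ∈ T, (H.graph.neighborSet u ∩ S).encard ≤ 1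

/-- A matching is a set of hyperedges that splits the set of all hypervertices. -/
def IsMatching (H : IncHypergraph V E) (M : Set E) : Prop :=
  H.Splits (Sum.inr '' M) (Set.range Sum.inl)

/-- An independent is a set of hypervertices that splits the set of all hyperedges. -/
def IsIndependent (H : IncHypergraph V E) (S : Set V) : Prop :=
  H.Splits (Sum.inl '' S) (Set.range Sum.inr)

/-- A transversal is a set of hypervertices that covers the set of all hyperedges. -/
def IsTransversal (H : IncHypergraph V E) (T : Set V) : Prop :=
  H.Covers (Sum.inl '' T) (Set.range Sum.inr)

/-- A hypergraph is balanced if it has no strong cycle of length `4k + 2`, `k ≥ 1`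
(lengths are measured in the incidence graph). -/
def Balanced (H : IncHypergraph V E) : Prop :=
  ∀ k : ℕ, 1 ≤ k → ¬ ∃ (a : V ⊕ E) (c : H.graph.Walk a a),
    c.IsCycle ∧ c.IsStrong ∧ c.length = 4 * k + 2

/-- The hypervertices of the augmented hypergraph: those of `H`, and two new ones. -/
inductive AugVertex (V : Type*) where
  | v₀ : AugVertex V
  | v₁ : AugVertex V
  | old : V → AugVertex V

/-- The hyperedges of the augmented hypergraph: those of `H`, a new one `e₀`, and a new one `f u`
for each `u ∈ U`. -/
inductive AugEdge {V : Type*} (E : Type*) (U : Set V) where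
  | e₀ : AugEdge E U
  | f : U → AugEdge E U
  | old : E → AugEdge E U

/-- The augmented hypergraph: `e₀` is incident exactly to `v₀` and `v₁`, each `f u` is incident
exactly to `v₁` and `u`, and the hyperedges of `H` keep their incident hypervertices. -/
def augment (H : IncHypergraph V E) (U : Set V) :
    IncHypergraph (AugVertex V) (AugEdge E U) where
  Inc
    | .v₀, .e₀ => True
    | .v₁, .e₀ => True
    | .old _, .e₀ => False
    | .v₀, .f _ => False
    | .v₁, .f _ => True
    | .old v, .f u => v = (u : V)
    | .v₀, .old _ => False
    | .v₁, .old _ => False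
    | .old v, .old e => H.Inc v e

/-- The sequence `x₀ g₀ x₁ g₁ … xₖ gₖ` of elements of `V ⊕ E` given by a list of pairs. -/
def seq (P : List (V × E)) : List (V ⊕ E) :=
  P.flatMap fun q => [Sum.inl q.1, Sum.inr q.2]

/-- The sequence `x₀ g₀ x₁ g₁ … xₖ gₖ` is a strong path in `H`. -/
def IsStrongPath (H : IncHypergraph V E) (P : List (V × E)) : Prop :=
  ∃ (a b : V ⊕ E) (p : H.graph.Walk a b), p.support = seq P ∧ p.IsPath ∧ p.IsStrong

/-- In the strong-path game a move at `P = x₀ g₀ … xₖ gₖ` appends a pair `(x, g)` of a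
hypervertex and a hyperedge; it is legal if the result is a strong path. -/
def IsLegalMove (H : IncHypergraph V E) (P : List (V × E)) (q : V × E) : Prop :=
  H.IsStrongPath (P ++ [q])

/-- It is the turn of Player `s` (`s = 1, 2`) at `P = x₀ g₀ … xₖ gₖ` when `k - 1 ≡ s (mod 2)`;
the list `P` has length `k + 1`. -/
def IsTurn (s : ℕ) (P : List (V × E)) : Prop :=
  P.length ≡ s [MOD 2]

/-- A strategy for Player `s`: it prescribes a move to each sequence, and the move is legal
whenever it is the turn of Player `s` and a legal move exists. -/
structure Strategy (H : IncHypergraph V E) (s : ℕ) where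
  /-- The prescribed move. -/
  move : List (V × E) → V × E
  legal : ∀ P, IsTurn s P → (∃ q, H.IsLegalMove P q) → H.IsLegalMove P (move P)

/-- The plays of the strong-path game started at `x g` in which Player `s` follows the strategy
`σ` and the other player makes arbitrary legal moves. -/
inductive Strategy.Play {H : IncHypergraph V E} {s : ℕ} (σ : H.Strategy s) (x : V) (g : E) :
    List (V × E) → Prop
  | start : σ.Play x g [(x, g)]
  | own {P : List (V × E)} : σ.Play x g P → IsTurn s P → H.IsLegalMove P (σ.move P) →
      σ.Play x g (P ++ [σ.move P])
  | other {P : List (V × E)} {q : V × E} : σ.Play x g P → ¬ IsTurn s P → H.IsLegalMove P q →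
      σ.Play x g (P ++ [q])

/-- A player whose turn it is and who has no legal move loses. The strategy `σ` of Player `s` is
winning if every play that follows `σ` and cannot be continued is lost by the other player. (When
`V` and `E` are finite, the length of a strong path is bounded, so no play goes on forever.) -/
def Strategy.IsWinning {H : IncHypergraph V E} {s : ℕ} (σ : H.Strategy s) (x : V) (g : E) : Prop :=
  ∀ P, σ.Play x g P → (¬ ∃ q, H.IsLegalMove P q) → ¬ IsTurn s P

/-- Player `s` has a winning strategy in the strong-path game on `H` started at `x g`. -/
def HasWinningStrategy (H : IncHypergraph V E) (x : V) (g : E) (s : ℕ) : Prop :=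
  ∃ σ : H.Strategy s, σ.IsWinning x g

end IncHypergraph

/-! Suppose a matching $M$ covers $U$. Whenever Player 2 has to move, the last hyperedge contains
exactly one $u\in U$, and the reply is $u$ with the hyperedge of $M$ at $u$. Independence of $U$ and
the matching property keep the path strong, so Player 2 is never stuck (`exists_reply_of_matching`).
Conversely, balanced hypergraphs have the Kőnig property: there are a matching $M$ and a transversal
$T$ such that $M$ covers $T$ and each hyperedge of $M$ meets $T$ only once
(`exists_matching_transversal_slack`). If no matching covers $U$, this $M$ misses some $u_0\in U$.
Player 1 opens with $v_1f_{u_0}$ and from then on picks $t\in T$ on the last hyperedge together with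
the hyperedge of $M$ at $t$. The only danger not excluded by slackness is that $t$ lies on an
earlier hyperedge of Player 2, and then it closes an odd strong cycle
(`exists_reply_of_transversal`). The Kőnig property comes from Berge's chain: no odd strong cycle
gives bicolourings (`exists_bicoloring`), these give edge colourings with maximum-degree many
colours (`exists_edgeColoring`), and these give the min-max equality
(`exists_matching_transversal`). -/

/-! ### Odd strong cycles of a relation, and balance -/

/-- A relation `R` has an odd strong cycle `v₀ e₀ v₁ e₁ … v₂ₖ e₂ₖ` with `k ≥ 1`. -/
def HasOddCycle {α β : Type*} (R : α → β → Prop) : Prop :=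
  ∃ (k : ℕ) (v : ℕ → α) (e : ℕ → β), 1 ≤ k ∧ ∀ i < 2 * k + 1, ∀ j < 2 * k + 1,
    (R (v i) (e j) ↔ i = j ∨ i = j + 1 ∨ (i = 0 ∧ j = 2 * k))

namespace HasOddCycle

variable {α β γ δ : Type*}

/-- No injectivity is needed, because the incidence pattern itself separates the entries. Hence
neither restricting to some hyperedges nor repeating hyperedges creates an odd cycle. -/
theorem comap {R : α → β → Prop} {f : γ → α} {g : δ → β}
    (h : HasOddCycle fun a b => R (f a) (g b)) : HasOddCycle R := by
  obtain ⟨k, v, e, hk, h⟩ := h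
  exact ⟨k, f ∘ v, g ∘ e, hk, h⟩

/-- The pattern is self-dual up to a cyclic shift: `v j` lies on `e (j - 1)` and `e j`, so `e (j -
1)` must take index `j`. -/
theorem flip {R : α → β → Prop} (h : HasOddCycle fun b a => R a b) : HasOddCycle R := by
  obtain ⟨k, v, e, hk, h⟩ := h
  dsimp only at h
  refine ⟨k, fun i => if i = 0 then e (2 * k) else e (i - 1), v, hk, fun i hi j hj => ?_⟩
  dsimp only
  split_ifs with h0
  · rw [h j hj _ (by omega)]; omega
  · rw [h j hj _ (by omega)]; omega

end HasOddCycle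

namespace SimpleGraph

theorem cycleGraph_adj_iff_val {n : ℕ} {u v : Fin (n + 3)} :
    (cycleGraph (n + 3)).Adj u v ↔ u.val = v.val + 1 ∨ v.val = u.val + 1 ∨
      (u.val = 0 ∧ v.val = n + 2) ∨ (v.val = 0 ∧ u.val = n + 2) := by
  rw [cycleGraph_adj']
  rcases lt_trichotomy u v with h | h | h
  · rw [Fin.coe_sub_iff_lt.2 h, Fin.coe_sub_iff_le.2 h.le]
    have := Fin.lt_def.1 h
    omega
  · subst h; rw [sub_self]; simp only [Fin.val_zero]; omega
  · rw [Fin.coe_sub_iff_lt.2 h, Fin.coe_sub_iff_le.2 h.le]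
    have := Fin.lt_def.1 h
    omega

theorem cycleGraph.mk_mem_edges_cycle {n : ℕ} {u v : Fin (n + 3)}
    (h : (cycleGraph (n + 3)).Adj u v) : s(u, v) ∈ (cycleGraph.cycle n).edges := by
  have key : ∀ u v : Fin (n + 3), (u.val = v.val + 1 ∨ (u.val = 0 ∧ v.val = n + 2)) →
      s(u, v) ∈ (cycleGraph.cycle n).edges := by
    intro u v h
    rw [Walk.mk_mem_edges_iff_exists]
    -- The walk runs through 0, n + 2, n + 1, …, so it leaves `u` at time n + 3 - u, or at time 0 if
    -- `u` is 0.
    refine ⟨if u.val = 0 then 0 else n + 3 - u.val, ?_, ?_⟩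
    · rw [cycleGraph.length_cycle]; split_ifs <;> omega
    · rw [cycleGraph.getVert_cycle (by split_ifs <;> omega),
        cycleGraph.getVert_cycle (by split_ifs <;> omega)]
      have hu := u.isLt
      have hv := v.isLt
      refine congrArg₂ (fun a b => s(a, b)) (Fin.ext ?_) (Fin.ext ?_)
      · dsimp only
        split_ifs with h0
        · simp [h0]
        · rw [show n + 3 - (n + 3 - u.val) = u.val by omega, Nat.mod_eq_of_lt hu]
      · dsimp only
        split_ifs with h0
        · rw [show n + 3 - (0 + 1) = v.val by omega, Nat.mod_eq_of_lt hv]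
        · rw [show n + 3 - (n + 3 - u.val + 1) = v.val by omega, Nat.mod_eq_of_lt hv]
  rcases cycleGraph_adj_iff_val.1 h with h | h | h | h
  · exact key u v (.inl h)
  · rw [Sym2.eq_swap]; exact key v u (.inl h)
  · exact key u v (.inr h)
  · rw [Sym2.eq_swap]; exact key v u (.inr h)

end SimpleGraph

theorem IncHypergraph.Balanced.not_hasOddCycle {V E : Type*} {H : IncHypergraph V E}
    (hH : H.Balanced) : ¬ HasOddCycle H.Inc := by
  rintro ⟨k, v, e, hk, h⟩
  obtain ⟨m, rfl⟩ : ∃ m, k = m + 1 := ⟨k - 1, by omega⟩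
  let f : Fin (4 * m + 3 + 3) → V ⊕ E := fun i =>
    if i.val % 2 = 0 then .inl (v (i.val / 2)) else .inr (e (i.val / 2))
  have hadj : ∀ i j, H.graph.Adj (f i) (f j) ↔
      (SimpleGraph.cycleGraph (4 * m + 3 + 3)).Adj i j := by
    intro i j
    have hi := i.isLt
    have hj := j.isLt
    rw [SimpleGraph.cycleGraph_adj_iff_val]
    simp only [f]
    split_ifs with h1 h2 h2
    · simp only [IncHypergraph.graph, false_iff]; omega
    · change H.Inc _ _ ↔ _
      rw [h _ (by omega) _ (by omega)]; omega
    · change H.Inc _ _ ↔ _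
      rw [h _ (by omega) _ (by omega)]; omega
    · simp only [IncHypergraph.graph, false_iff]; omega
  have hinj : Function.Injective f := by
    intro i j hij
    have hi := i.isLt
    have hj := j.isLt
    -- With at least three hypervertices, no two of them lie on the same two hyperedges of the
    -- cycle.
    have hv : ∀ a ≤ 2 * (m + 1), ∀ b ≤ 2 * (m + 1), v a = v b → a = b := by
      intro a ha b hb hab
      have h1 := (h a (by omega) a (by omega)).2 (by omega)
      have h2 := (h b (by omega) b (by omega)).2 (by omega)
      rw [hab, h b (by omega) a (by omega)] at h1
      rw [← hab, h a (by omega) b (by omega)] at h2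
      omega
    have he : ∀ a ≤ 2 * (m + 1), ∀ b ≤ 2 * (m + 1), e a = e b → a = b := by
      intro a ha b hb hab
      have h1 := (h a (by omega) a (by omega)).2 (by omega)
      have h2 := (h b (by omega) b (by omega)).2 (by omega)
      rw [hab, h a (by omega) b (by omega)] at h1
      rw [← hab, h b (by omega) a (by omega)] at h2
      omega
    simp only [f] at hij
    split_ifs at hij with h1 h2 h2
    · have := hv _ (by omega) _ (by omega) (Sum.inl_injective hij)
      omega
    · have := he _ (by omega) _ (by omega) (Sum.inr_injective hij)
      omega
  let φ : SimpleGraph.cycleGraph (4 * m + 3 + 3) →g H.graph := ⟨f, fun h => (hadj _ _).2 h⟩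
  refine hH (m + 1) hk ⟨_, (SimpleGraph.cycleGraph.cycle (4 * m + 3)).map φ,
    SimpleGraph.cycleGraph.isCycle_cycle.map hinj, ?_, by simp; omega⟩
  intro x hx y hy hxy
  rw [SimpleGraph.Walk.support_map, List.mem_map] at hx hy
  obtain ⟨a, -, rfl⟩ := hx
  obtain ⟨b, -, rfl⟩ := hy
  rw [SimpleGraph.Walk.edges_map, List.mem_map]
  exact ⟨s(a, b), SimpleGraph.cycleGraph.mk_mem_edges_cycle ((hadj a b).1 hxy), rfl⟩

/-! ### Bicolouring, edge colouring and the Kőnig property -/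

/-- The vertices of a relation without odd strong cycles can be coloured with two colours such that
no edge with at least two vertices is monochromatic. -/
theorem exists_bicoloring {α β : Type*} [Finite α] {R : α → β → Prop} (hR : ¬ HasOddCycle R) :
    ∃ c : α → Bool, ∀ b, (∃ a a', a ≠ a' ∧ R a b ∧ R a' b) →
      ∃ a a', R a b ∧ R a' b ∧ c a ≠ c a' := by
  classical
  have := Fintype.ofFinite α
  suffices H : ∀ S : Finset α, ∃ c : α → Bool, ∀ b,
      (∃ a ∈ S, ∃ a' ∈ S, a ≠ a' ∧ R a b ∧ R a' b) →
      ∃ a ∈ S, ∃ a' ∈ S, R a b ∧ R a' b ∧ c a ≠ c a' by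
    simpa using H Finset.univ
  intro S
  induction S using Finset.strongInduction with
  | H S ih =>
  rcases S.eq_empty_or_nonempty with rfl | ⟨s, hs⟩
  · simp
  by_contra! hcon
  -- `S` is a minimal set without a bicolouring. The edges of `G` are the two-element traces on `S`;
  -- the end `x` of a longest path has all its neighbours on that path.
  let G : SimpleGraph S :=
    { Adj := fun a a' => a ≠ a' ∧ ∃ b, ∀ s ∈ S, R s b ↔ s = a ∨ s = a'
      symm := ⟨by
        rintro a a' ⟨h, b, hb⟩
        exact ⟨h.symm, b, fun s hs => (hb s hs).trans or_comm⟩⟩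
      loopless := ⟨fun a h => h.1 rfl⟩ }
  have : Nonempty S := ⟨⟨s, hs⟩⟩
  obtain ⟨x, y, p, hp, hmax⟩ := SimpleGraph.Walk.exists_isPath_forall_isPath_length_le_length G
  obtain ⟨c, hc⟩ := ih (S.erase x) (Finset.erase_ssubset x.2)
  -- Giving `x` the colour `d` leaves some hyperedge monochromatic. Since `c` bicolours `S` without
  -- `x`, that hyperedge has only one further element in `S`, necessarily of colour `d`.
  have hnb : ∀ d : Bool, ∃ y : S, G.Adj x y ∧ c y = d := by
    intro d
    obtain ⟨b, ⟨a, ha, a', ha', hne, hab, ha'b⟩, hmono⟩ := hcon (Function.update c x d)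
    have hone : ∀ a ∈ S, ∀ a' ∈ S, R a b → R a' b → a ≠ x → a' ≠ x → a = a' := by
      intro a ha a' ha' hab ha'b hx hx'
      by_contra hne
      obtain ⟨u, hu, u', hu', hub, hu'b, hcu⟩ := hc b
        ⟨a, Finset.mem_erase.2 ⟨hx, ha⟩, a', Finset.mem_erase.2 ⟨hx', ha'⟩, hne, hab, ha'b⟩
      rw [Finset.mem_erase] at hu hu'
      have := hmono u hu.2 u' hu'.2 hub hu'b
      rw [Function.update_of_ne hu.1, Function.update_of_ne hu'.1] at this
      exact hcu this
    have main : ∀ a ∈ S, R x b → R a b → a ≠ x → ∃ y : S, G.Adj x y ∧ c y = d := by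
      intro a ha hxb hab hax
      refine ⟨⟨a, ha⟩, ⟨fun h => hax (congrArg Subtype.val h).symm, b, fun s hs => ⟨fun hsb => ?_, ?_⟩⟩, ?_⟩
      · by_cases hsx : s = x
        · exact .inl hsx
        · exact .inr (hone s hs a ha hsb hab hsx hax)
      · rintro (rfl | rfl) <;> assumption
      · have := hmono a ha x x.2 hab hxb
        rwa [Function.update_of_ne hax, Function.update_self] at this
    by_cases hax : a = x
    · subst hax; exact main a' ha' hab ha'b (Ne.symm hne)
    · by_cases hax' : a' = x
      · subst hax'; exact main a ha ha'b hab hax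
      · exact absurd (hone a ha a' ha' hab ha'b hax hax') hne
  have hpos : ∀ y : S, G.Adj x y → ∃ i, 1 ≤ i ∧ i ≤ p.length ∧ p.getVert i = y := by
    intro y hxy
    have hy : y ∈ p.support := by
      by_contra hy
      have := hmax _ _ (p.cons hxy.symm) (hp.cons hy)
      simp at this
    obtain ⟨i, hi, hil⟩ := SimpleGraph.Walk.mem_support_iff_exists_getVert.1 hy
    refine ⟨i, Nat.one_le_iff_ne_zero.2 ?_, hil, hi⟩
    rintro rfl
    rw [SimpleGraph.Walk.getVert_zero] at hi
    exact hxy.ne hi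
  have hinj : ∀ i ≤ p.length, ∀ j ≤ p.length, ((p.getVert i : α) = p.getVert j ↔ i = j) :=
    fun i hi j hj => ⟨fun h => hp.getVert_injOn hi hj (Subtype.ext h), fun h => by rw [h]⟩
  have hx0 : (x : α) = p.getVert 0 := by rw [SimpleGraph.Walk.getVert_zero]
  have hedge : ∀ i < p.length, ∃ b, ∀ s ∈ S, R s b ↔ s = p.getVert i ∨ s = p.getVert (i + 1) :=
    fun i hi => (p.adj_getVert_succ hi).2
  have halt : ∀ i, 1 ≤ i → i < p.length → c (p.getVert (i + 1)) = !c (p.getVert i) := by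
    intro i h1 hi
    obtain ⟨b, hb⟩ := hedge i hi
    have hi0 := (hinj i hi.le 0 (by omega)).not.2 (by omega)
    have hi1 := (hinj (i + 1) hi 0 (by omega)).not.2 (by omega)
    rw [← hx0] at hi0 hi1
    obtain ⟨u, hu, u', hu', hub, hu'b, hcu⟩ := hc b
      ⟨_, Finset.mem_erase.2 ⟨hi0, Subtype.property _⟩, _,
        Finset.mem_erase.2 ⟨hi1, Subtype.property _⟩, (hinj i hi.le (i + 1) hi).not.2 (by omega),
        (hb _ (Subtype.property _)).2 (.inl rfl), (hb _ (Subtype.property _)).2 (.inr rfl)⟩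
    rw [hb _ (Finset.mem_of_mem_erase hu)] at hub
    rw [hb _ (Finset.mem_of_mem_erase hu')] at hu'b
    rcases hub with rfl | rfl <;> rcases hu'b with rfl | rfl
    · exact absurd rfl hcu
    · exact Bool.eq_not_of_ne hcu.symm
    · exact Bool.eq_not_of_ne hcu
    · exact absurd rfl hcu
  have hpar : ∀ i d, 1 ≤ i → i + d ≤ p.length →
      (c (p.getVert (i + d)) = c (p.getVert i) ↔ Even d) := by
    intro i d hi
    induction d with
    | zero => simp
    | succ d ihd =>
      intro hd
      rw [← add_assoc, halt (i + d) (by omega) (by omega), Nat.even_add_one, ← ihd (by omega)]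
      cases c (p.getVert (i + d)) <;> cases c (p.getVert i) <;> simp
  -- Colours alternate along the path after `x`, so neighbours of `x` of different colours are at
  -- odd distance on it, and `x` closes the segment between them to an odd cycle. It is strong
  -- because all hyperedges used meet `S` in two elements only.
  have main : ∀ y z : S, G.Adj x y → G.Adj x z → c y ≠ c z → ∀ i d, 1 ≤ i → i + d ≤ p.length →
      p.getVert i = y → p.getVert (i + d) = z → False := by
    rintro y z hxy hxz hyz i d hi hd rfl rfl
    obtain ⟨k, rfl⟩ : Odd d := by
      rw [← Nat.not_even_iff_odd, ← hpar i d hi hd]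
      exact hyz.symm
    obtain ⟨-, b₁, hb₁⟩ := hxy
    obtain ⟨-, b₂, hb₂⟩ := hxz
    rw [hx0] at hb₁ hb₂
    have : Nonempty β := ⟨b₁⟩
    choose! e he using hedge
    refine hR ⟨k + 1, fun j => if j = 0 then x else p.getVert (i + j - 1),
      fun j => if j = 0 then b₁ else if j = 2 * (k + 1) then b₂ else e (i + j - 1), by omega,
      fun a ha b hb => ?_⟩
    have hv : (if a = 0 then (x : α) else p.getVert (i + a - 1)) =
        p.getVert (if a = 0 then 0 else i + a - 1) := by
      split_ifs
      · exact hx0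
      · rfl
    dsimp only
    rw [hv]
    have hal : (if a = 0 then 0 else i + a - 1) ≤ p.length := by split_ifs <;> omega
    by_cases hb0 : b = 0
    · rw [if_pos hb0, hb₁ _ (Subtype.property _), hinj _ hal _ (by omega),
        hinj _ hal _ (by omega)]
      split_ifs <;> omega
    · rw [if_neg hb0]
      by_cases hbk : b = 2 * (k + 1)
      · rw [if_pos hbk, hb₂ _ (Subtype.property _), hinj _ hal _ (by omega),
          hinj _ hal _ (by omega)]
        split_ifs <;> omega
      · rw [if_neg hbk, he (i + b - 1) (by omega) _ (Subtype.property _),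
          hinj _ hal _ (by omega), hinj _ hal _ (by omega)]
        split_ifs <;> (try simp only [or_false]) <;> omega
  obtain ⟨y, hxy, hy⟩ := hnb true
  obtain ⟨z, hxz, hz⟩ := hnb false
  obtain ⟨i, hi, hil, hiy⟩ := hpos y hxy
  obtain ⟨j, hj, hjl, hjz⟩ := hpos z hxz
  rcases le_total i j with hij | hij
  · exact main y z hxy hxz (by simp [hy, hz]) i (j - i) hi (by omega) hiy
      (by rw [Nat.add_sub_cancel' hij, hjz])
  · exact main z y hxz hxy (by simp [hy, hz]) j (i - j) hj (by omega) hjz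
      (by rw [Nat.add_sub_cancel' hij, hiy])

open Finset in
/-- The edges of a relation without odd strong cycles can be properly coloured with as many colours
as the maximum degree of a vertex. -/
theorem exists_edgeColoring {V E : Type*} [Finite V] [Finite E] {R : V → E → Prop}
    (hR : ¬ HasOddCycle R) {k : ℕ} (hk : 0 < k)
    (hdeg : ∀ v (S : Finset E), (∀ e ∈ S, R v e) → #S ≤ k) :
    ∃ c : E → Fin k, ∀ v e e', R v e → R v e' → c e = c e' → e = e' := by
  classical
  have := Fintype.ofFinite V
  have := Fintype.ofFinite E
  have : Nonempty (Fin k) := ⟨⟨0, hk⟩⟩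
  let N : (E → Fin k) → V → Finset (Fin k) := fun c v => ({e | R v e} : Finset E).image c
  have hN : ∀ c v i, i ∈ N c v ↔ ∃ e, R v e ∧ c e = i := by simp [N]
  obtain ⟨c, hc⟩ := Finite.exists_max fun c => ∑ v, #(N c v)
  refine ⟨c, ?_⟩
  by_contra! ⟨v, e, e', hve, hve', hcc, hne⟩
  obtain ⟨j, hj⟩ : ∃ j, j ∉ N c v := by
    by_contra! hall
    have h1 : k ≤ #(N c v) := by
      rw [Finset.eq_univ_of_forall hall]; simp
    have h2 := hdeg v ({e | R v e} : Finset E) (by simp)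
    have h3 : #(N c v) = #({e | R v e} : Finset E) :=
      le_antisymm Finset.card_image_le (h2.trans h1)
    exact hne (Finset.card_image_iff.1 h3 (by simpa using hve) (by simpa using hve') hcc)
  set i := c e with hi
  have hij : i ≠ j := fun h => hj ((hN _ _ _).2 ⟨e, hve, h⟩)
  -- The hyperedges of colours `i` and `j` are recoloured by a bicolouring of the dual, so a vertex
  -- on at least two of them now sees both colours.
  obtain ⟨d, hd⟩ := exists_bicoloring (α := {e // c e = i ∨ c e = j}) (β := V)
    (R := fun a v => R v a.1) fun h => hR (h.flip.comap (f := id) (g := Subtype.val))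
  let c' : E → Fin k := fun e => if h : c e = i ∨ c e = j then (if d ⟨e, h⟩ then i else j) else c e
  have hc'pos : ∀ a : {e // c e = i ∨ c e = j}, c' a = if d a then i else j := fun a =>
    dif_pos a.2
  have hc'neg : ∀ e, ¬ (c e = i ∨ c e = j) → c' e = c e := fun e h => dif_neg h
  have htwo : ∀ w (a a' : {e // c e = i ∨ c e = j}), a ≠ a' → R w a → R w a' →
      insert i (insert j (N c w)) ⊆ N c' w := by
    intro w a a' hne ha ha'
    obtain ⟨b, b', hb, hb', hdb⟩ := hd w ⟨a, a', hne, ha, ha'⟩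
    have hboth : i ∈ N c' w ∧ j ∈ N c' w := by
      simp only [hN]
      cases h1 : d b <;> cases h2 : d b'
      · simp [h1, h2] at hdb
      · exact ⟨⟨b', hb', by simp [hc'pos, h2]⟩, ⟨b, hb, by simp [hc'pos, h1]⟩⟩
      · exact ⟨⟨b, hb, by simp [hc'pos, h1]⟩, ⟨b', hb', by simp [hc'pos, h2]⟩⟩
      · simp [h1, h2] at hdb
    intro l hl
    rw [mem_insert, mem_insert, hN] at hl
    rcases hl with rfl | rfl | ⟨f, hf, rfl⟩
    · exact hboth.1
    · exact hboth.2
    · by_cases h : c f = i ∨ c f = j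
      · rcases h with h | h <;> rw [h]
        exacts [hboth.1, hboth.2]
      · exact (hN _ _ _).2 ⟨f, hf, hc'neg f h⟩
  have hle : ∀ w, #(N c w) ≤ #(N c' w) := by
    intro w
    by_cases h2 : ∃ a a' : {e // c e = i ∨ c e = j}, a ≠ a' ∧ R w a ∧ R w a'
    · obtain ⟨a, a', hne, ha, ha'⟩ := h2
      exact card_le_card (((subset_insert _ _).trans (subset_insert _ _)).trans
        (htwo w a a' hne ha ha'))
    push Not at h2
    -- A vertex on at most one recoloured hyperedge sees at most a renaming of its colours, so it
    -- loses none in number.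
    obtain ⟨τ, hτ⟩ : ∃ τ : Equiv.Perm (Fin k), ∀ f, R w f → c' f = τ (c f) := by
      have hfix : ∀ τ : Equiv.Perm (Fin k), (∀ l, ¬ (l = i ∨ l = j) → τ l = l) →
          (∀ a : {e // c e = i ∨ c e = j}, R w a → c' a = τ (c a)) →
          ∀ f, R w f → c' f = τ (c f) := by
        intro τ h1 h2 f hf
        by_cases h : c f = i ∨ c f = j
        · exact h2 ⟨f, h⟩ hf
        · rw [hc'neg f h, h1 _ h]
      by_cases h1 : ∃ a : {e // c e = i ∨ c e = j}, R w a ∧ c' a ≠ c a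
      · obtain ⟨a, ha, hca⟩ := h1
        refine ⟨Equiv.swap i j, hfix _ (fun l hl => ?_) fun b hb => ?_⟩
        · rw [not_or] at hl
          exact Equiv.swap_apply_of_ne_of_ne hl.1 hl.2
        · obtain rfl : a = b := by
            by_contra hab
            exact h2 a b hab ha hb
          rw [hc'pos] at hca ⊢
          rcases a.2 with h | h <;> rw [h] at hca ⊢ <;> split_ifs at hca ⊢ <;> simp_all
      · push Not at h1
        exact ⟨1, hfix _ (fun _ _ => rfl) h1⟩
    rw [← card_map τ.toEmbedding]
    refine card_le_card fun l hl => ?_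
    rw [mem_map] at hl
    obtain ⟨m, hm, rfl⟩ := hl
    obtain ⟨f, hf, rfl⟩ := (hN _ _ _).1 hm
    exact (hN _ _ _).2 ⟨f, hf, hτ f hf⟩
  have hlt : #(N c v) < #(N c' v) := by
    refine card_lt_card ((ssubset_iff_of_subset ?_).2 ⟨j, ?_, hj⟩)
    all_goals have := htwo v ⟨e, .inl rfl⟩ ⟨e', .inl hcc.symm⟩ (by simpa using hne) hve hve'
    · exact ((subset_insert _ _).trans (subset_insert _ _)).trans this
    · exact this (by simp)
  exact absurd (hc c') (not_le.2 (sum_lt_sum (fun w _ => hle w) ⟨v, mem_univ v, hlt⟩))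

open Finset in
/-- **Kőnig property** of relations without odd strong cycles. -/
theorem exists_matching_transversal {V E : Type*} [Finite V] [Finite E] {R : V → E → Prop}
    (hR : ¬ HasOddCycle R) (hne : ∀ e, ∃ v, R v e) :
    ∃ (M : Finset E) (T : Finset V), (∀ v, ∀ e ∈ M, ∀ e' ∈ M, R v e → R v e' → e = e') ∧
      (∀ e, ∃ v ∈ T, R v e) ∧ #T ≤ #M := by
  classical
  have := Fintype.ofFinite V
  have := Fintype.ofFinite E
  suffices H : ∀ F : Finset E, ∃ (M : Finset E) (T : Finset V), M ⊆ F ∧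
      (∀ v, ∀ e ∈ M, ∀ e' ∈ M, R v e → R v e' → e = e') ∧
      (∀ e ∈ F, ∃ v ∈ T, R v e) ∧ #T ≤ #M by
    obtain ⟨M, T, -, hM, hT, h⟩ := H univ
    exact ⟨M, T, hM, fun e => hT e (mem_univ e), h⟩
  intro F
  induction F using Finset.strongInduction with
  | H F ih =>
  by_contra! hcon
  obtain ⟨M₀, hM₀, hmax⟩ := exists_max_image
    ({M ∈ F.powerset | ∀ v, ∀ e ∈ M, ∀ e' ∈ M, R v e → R v e' → e = e'}) card ⟨∅, by simp⟩
  rw [mem_filter, mem_powerset] at hM₀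
  have hmax : ∀ M ⊆ F, (∀ v, ∀ e ∈ M, ∀ e' ∈ M, R v e → R v e' → e = e') → #M ≤ #M₀ :=
    fun M h h' => hmax M (mem_filter.2 ⟨mem_powerset.2 h, h'⟩)
  obtain ⟨f, hf⟩ : F.Nonempty := by
    rw [nonempty_iff_ne_empty]
    rintro rfl
    simpa using hcon ∅ ∅
  have hpos : 0 < #M₀ := (hmax {f} (by simpa using hf) (by simp)).trans_lt' (by simp)
  let X := {x : V // ∃ e ∈ F, R x e}
  -- Deleting the hyperedges at `x` does not lower the matching number: by minimality the rest has a
  -- transversal no larger than a matching, and adding `x` to it gives a transversal of `F`, which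
  -- exceeds `M₀`.
  have hX : ∀ x : X, ∃ M ⊆ F, (∀ v, ∀ e ∈ M, ∀ e' ∈ M, R v e → R v e' → e = e') ∧
      (∀ e ∈ M, ¬ R x e) ∧ #M₀ ≤ #M := by
    rintro ⟨x, e, he, hxe⟩
    obtain ⟨M, T, hMF, hM, hT, hTM⟩ := ih (F.filter fun e => ¬ R x e)
      (filter_ssubset.2 ⟨e, he, by simpa using hxe⟩)
    refine ⟨M, hMF.trans (filter_subset _ _), hM, fun e he => (mem_filter.1 (hMF he)).2, ?_⟩
    have := hcon M₀ (insert x T) hM₀.1 hM₀.2 fun e he => by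
      by_cases hxe : R x e
      · exact ⟨x, by simp, hxe⟩
      · obtain ⟨v, hv, hve⟩ := hT e (mem_filter.2 ⟨he, hxe⟩)
        exact ⟨v, by simp [hv], hve⟩
    have := card_insert_le x T
    omega
  choose M hMF hM hMx hMc using hX
  have hcard : #M₀ * Fintype.card X ≤ Fintype.card (Σ x : X, M x) := by
    rw [Fintype.card_sigma]
    simp only [Fintype.card_coe]
    calc #M₀ * Fintype.card X = ∑ x : X, #M₀ := by simp [mul_comm]
      _ ≤ _ := sum_le_sum fun x _ => hMc x
  -- In the disjoint union of the matchings `M x`, a vertex `v` has at most one hyperedge from each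
  -- of them and none from `M v`. One colour fewer than there are elements of `X` thus suffices, and
  -- some colour class is a matching larger than `M₀`.
  have hdeg : ∀ v (S : Finset (Σ x : X, M x)), (∀ e ∈ S, R v e.2.1) →
      #S ≤ Fintype.card X - 1 := by
    intro v S hS
    rcases S.eq_empty_or_nonempty with rfl | ⟨s, hs⟩
    · simp
    let y : X := ⟨v, s.2.1, hMF _ s.2.2, hS s hs⟩
    calc #S ≤ #((univ : Finset X).erase y) := by
          refine card_le_card_of_injOn Sigma.fst (fun e he => ?_) ?_
          · refine mem_coe.2 (mem_erase.2 ⟨fun h => ?_, mem_univ _⟩)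
            have hv : (e.1 : V) = v := congrArg Subtype.val h
            exact hMx e.1 _ e.2.2 (Eq.subst (motive := fun w => R w e.2.1) hv.symm (hS e he))
          · rintro ⟨x, e⟩ he ⟨x', e'⟩ he' (rfl : x = x')
            have := hM x v e.1 e.2 e'.1 e'.2 (hS _ he) (hS _ he')
            rw [Subtype.ext this]
      _ = _ := by rw [card_erase_of_mem (mem_univ _), card_univ]
  have hn : 0 < Fintype.card X - 1 := by
    obtain ⟨w, hw⟩ := hne f
    obtain ⟨e, he⟩ : (M ⟨w, f, hf, hw⟩).Nonempty := card_pos.1 (hpos.trans_le (hMc _))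
    obtain ⟨v, hv⟩ := hne e
    have := hdeg v {⟨_, e, he⟩} (by simpa using hv)
    rwa [card_singleton] at this
  obtain ⟨c, hc⟩ := exists_edgeColoring (R := fun v (e : Σ x : X, M x) => R v e.2.1)
    (fun h => hR (h.comap (f := id))) hn hdeg
  obtain ⟨i, -, hi⟩ := exists_lt_card_fiber_of_mul_lt_card_of_maps_to (s := univ) (t := univ)
    (f := c) (n := #M₀) (fun _ _ => mem_univ _) (by
      rw [card_univ, card_univ, Fintype.card_fin]
      refine hcard.trans_lt' ?_
      rw [mul_comm]
      exact Nat.mul_lt_mul_of_pos_left (by omega) hpos)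
  refine absurd (hmax (image (fun e => e.2.1) {e | c e = i}) ?_ ?_) (not_le.2 ?_)
  · simp only [image_subset_iff]
    exact fun e _ => hMF _ e.2.2
  · intro v a ha a' ha' hva hva'
    simp only [mem_image, mem_filter, mem_univ, true_and] at ha ha'
    obtain ⟨e, he, rfl⟩ := ha
    obtain ⟨e', he', rfl⟩ := ha'
    rw [hc v e e' hva hva' (he.trans he'.symm)]
  -- Copies of one hyperedge share a vertex, as hyperedges are nonempty, so they never have the same
  -- colour.
  · rwa [card_image_of_injOn]
    intro e he e' he' hee
    simp only [coe_filter, mem_univ, true_and, Set.mem_ofPred_eq] at he he'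
    obtain ⟨v, hv⟩ := hne e.2.1
    dsimp only at hee
    exact hc v e e' hv (hee ▸ hv) (he.trans he'.symm)

/-- The Kőnig property in complementary slackness form. -/
theorem exists_matching_transversal_slack {V E : Type*} [Finite V] [Finite E] {R : V → E → Prop}
    (hR : ¬ HasOddCycle R) (hne : ∀ e, ∃ v, R v e) :
    ∃ (M : Set E) (T : Set V), (∀ v, ∀ e ∈ M, ∀ e' ∈ M, R v e → R v e' → e = e') ∧
      (∀ e, ∃ v ∈ T, R v e) ∧ (∀ v ∈ T, ∃ e ∈ M, R v e) ∧
      (∀ e ∈ M, ∀ v ∈ T, ∀ v' ∈ T, R v e → R v' e → v = v') := by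
  obtain ⟨M, T, hM, hT, hTM⟩ := exists_matching_transversal hR hne
  choose t ht hte using hT
  -- Choosing a point of `T` on each hyperedge is injective on the matching, hence by cardinality a
  -- bijection onto `T`; both slackness conditions follow.
  have hsurj := Finset.surjOn_of_injOn_of_card_le t (s := M) (t := T) (fun e _ => ht e)
    (fun e he e' he' hee => hM _ e he e' he' (hte e) (hee ▸ hte e')) hTM
  have hu : ∀ e ∈ M, ∀ v ∈ T, R v e → v = t e := by
    intro e he v hv hve
    obtain ⟨e', he', rfl⟩ := hsurj hv
    rw [hM _ e he e' he' hve (hte e')]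
  refine ⟨M, T, hM, fun e => ⟨t e, ht e, hte e⟩, fun v hv => ?_,
    fun e he v hv v' hv' h h' => (hu e he v hv h).trans (hu e he v' hv' h').symm⟩
  obtain ⟨e, he, rfl⟩ := hsurj hv
  exact ⟨e, he, hte e⟩

/-! ### Strong paths as incidence patterns -/

namespace IncHypergraph

variable {V E : Type*} {H : IncHypergraph V E}

theorem length_seq (P : List (V × E)) : (seq P).length = 2 * P.length := by
  induction P with
  | nil => rfl
  | cons q P ih => simp [seq] at ih ⊢; omega

theorem seq_getElem?_even (P : List (V × E)) (i : ℕ) :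
    (seq P)[2 * i]? = P[i]?.map fun q => .inl q.1 := by
  induction P generalizing i with
  | nil => simp [seq]
  | cons q P ih =>
    cases i with
    | zero => simp [seq]
    | succ i => simpa [seq, mul_add] using ih i

theorem seq_getElem?_odd (P : List (V × E)) (i : ℕ) :
    (seq P)[2 * i + 1]? = P[i]?.map fun q => .inr q.2 := by
  induction P generalizing i with
  | nil => simp [seq]
  | cons q P ih =>
    cases i with
    | zero => simp [seq]
    | succ i => simpa [seq, mul_add] using ih i

/-- The incidence pattern determines everything, including that the entries are distinct; walks do
not occur after this point. -/
theorem isStrongPath_iff {P : List (V × E)} :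
    H.IsStrongPath P ↔ P ≠ [] ∧ ∀ i (hi : i < P.length) j (hj : j < P.length),
      (H.Inc P[i].1 P[j].2 ↔ i = j ∨ i = j + 1) := by
  constructor
  · rintro ⟨a, b, p, hsupp, hpath, hstrong⟩
    have hlen : p.length + 1 = 2 * P.length := by
      rw [← SimpleGraph.Walk.length_support, hsupp, length_seq]
    have he : ∀ i (hi : i < P.length), p.getVert (2 * i) = .inl P[i].1 := fun i hi => by
      have := p.getVert_eq_support_getElem? (n := 2 * i) (by omega)
      rw [hsupp, seq_getElem?_even, List.getElem?_eq_getElem hi] at this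
      simpa using this
    have ho : ∀ i (hi : i < P.length), p.getVert (2 * i + 1) = .inr P[i].2 := fun i hi => by
      have := p.getVert_eq_support_getElem? (n := 2 * i + 1) (by omega)
      rw [hsupp, seq_getElem?_odd, List.getElem?_eq_getElem hi] at this
      simpa using this
    refine ⟨by rintro rfl; simp at hlen, fun i hi j hj => ⟨fun h => ?_, ?_⟩⟩
    · have hadj : H.graph.Adj (p.getVert (2 * i)) (p.getVert (2 * j + 1)) := by
        rw [he i hi, ho j hj]; exact h
      have := hstrong _ (p.getVert_mem_support _) _ (p.getVert_mem_support _) hadj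
      rw [SimpleGraph.Walk.mk_mem_edges_iff_exists] at this
      obtain ⟨k, hk, hs⟩ := this
      rw [Sym2.eq_iff] at hs
      have hinj := hpath.getVert_injOn
      rcases hs with ⟨h1, h2⟩ | ⟨h1, h2⟩
      · have h1 := hinj (show k ≤ p.length by omega) (show 2 * i ≤ p.length by omega) h1
        have h2 := hinj (show k + 1 ≤ p.length by omega) (show 2 * j + 1 ≤ p.length by omega) h2
        omega
      · have h1 := hinj (show k ≤ p.length by omega) (show 2 * j + 1 ≤ p.length by omega) h1
        have h2 := hinj (show k + 1 ≤ p.length by omega) (show 2 * i ≤ p.length by omega) h2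
        omega
    · rintro (rfl | rfl)
      · have := p.adj_getVert_succ (i := 2 * i) (by omega)
        rw [he i hi, ho i hi] at this
        exact this
      · have := p.adj_getVert_succ (i := 2 * j + 1) (by omega)
        rw [show 2 * j + 1 + 1 = 2 * (j + 1) by ring, he (j + 1) hi, ho j hj] at this
        exact this
  · rintro ⟨hne, h⟩
    have hlen := length_seq P
    have he : ∀ i (hi : i < P.length) (hi' : 2 * i < (seq P).length),
        (seq P)[2 * i] = .inl P[i].1 := fun i hi hi' => by
      have := seq_getElem?_even P i
      rw [List.getElem?_eq_getElem hi', List.getElem?_eq_getElem hi] at this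
      simpa using this
    have ho : ∀ i (hi : i < P.length) (hi' : 2 * i + 1 < (seq P).length),
        (seq P)[2 * i + 1] = .inr P[i].2 := fun i hi hi' => by
      have := seq_getElem?_odd P i
      rw [List.getElem?_eq_getElem hi', List.getElem?_eq_getElem hi] at this
      simpa using this
    have hadj : ∀ m (hm : m < (seq P).length) n (hn : n < (seq P).length),
        (H.graph.Adj (seq P)[m] (seq P)[n] ↔ m = n + 1 ∨ n = m + 1) := by
      intro m hm n hn
      rcases Nat.even_or_odd' m with ⟨i, rfl | rfl⟩ <;> rcases Nat.even_or_odd' n with ⟨j, rfl | rfl⟩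
      · rw [he i (by omega), he j (by omega)]
        simp only [graph, false_iff]; omega
      · rw [he i (by omega), ho j (by omega)]
        simp only [graph]
        rw [h]; omega
      · rw [ho i (by omega), he j (by omega)]
        simp only [graph]
        rw [h]; omega
      · rw [ho i (by omega), ho j (by omega)]
        simp only [graph, false_iff]; omega
    have hnd : (seq P).Nodup := by
      rw [List.nodup_iff_injective_get]
      rintro ⟨m, hm⟩ ⟨n, hn⟩ hmn
      rw [List.get_eq_getElem, List.get_eq_getElem] at hmn
      dsimp only at hmn
      -- Equal entries would have neighbours at the same positions. On a path with an even number of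
      -- vertices this determines the position.
      have key : ∀ l (hl : l < (seq P).length), (m = l + 1 ∨ l = m + 1 ↔ n = l + 1 ∨ l = n + 1) :=
        fun l hl => by rw [← hadj m hm l hl, ← hadj n hn l hl, hmn]
      have hpar : m % 2 = n % 2 := by
        rcases Nat.even_or_odd' m with ⟨i, rfl | rfl⟩ <;>
          rcases Nat.even_or_odd' n with ⟨j, rfl | rfl⟩
        · omega
        · rw [he i (by omega), ho j (by omega)] at hmn; simp at hmn
        · rw [ho i (by omega), he j (by omega)] at hmn; simp at hmn
        · omega
      rw [Fin.mk.injEq]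
      rcases Nat.even_or_odd' m with ⟨i, rfl | rfl⟩
      · have h1 := (key (2 * i + 1) (by omega)).1 (by omega)
        have h2 := (key (n + 1) (by omega)).2 (by omega)
        omega
      · have h1 := (key (2 * i) (by omega)).1 (by omega)
        have h2 := (key (n - 1) (by omega)).2 (by omega)
        omega
    have hne' : seq P ≠ [] := by
      rw [← List.length_pos_iff] at hne ⊢
      omega
    have hchain : (seq P).IsChain H.graph.Adj := by
      rw [List.isChain_iff_getElem]
      intro i hi
      rw [hadj]; omega
    refine ⟨_, _, .ofSupport (seq P) hne' hchain, SimpleGraph.Walk.support_ofSupport _ _, ?_, ?_⟩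
    · rwa [SimpleGraph.Walk.isPath_def, SimpleGraph.Walk.support_ofSupport]
    · intro x hx y hy hxy
      have hl := SimpleGraph.Walk.length_ofSupport hne' hchain
      rw [SimpleGraph.Walk.support_ofSupport] at hx hy
      obtain ⟨m, hm, rfl⟩ := List.getElem_of_mem hx
      obtain ⟨n, hn, rfl⟩ := List.getElem_of_mem hy
      have hg : ∀ l (hl : l < (seq P).length),
          (SimpleGraph.Walk.ofSupport (seq P) hne' hchain).getVert l = (seq P)[l] := fun l hl => by
        rw [SimpleGraph.Walk.getVert_eq_support_getElem _ (by omega)]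
        simp only [SimpleGraph.Walk.support_ofSupport]
      rw [SimpleGraph.Walk.mk_mem_edges_iff_exists]
      rcases (hadj m hm n hn).1 hxy with rfl | rfl
      · exact ⟨n, by omega, by rw [hg _ hn, hg _ hm, Sym2.eq_swap]⟩
      · exact ⟨m, by omega, by rw [hg _ hn, hg _ hm]⟩

/-- Appending a pair to a strong path gives a strong path exactly if the new hypervertex lies in the
last hyperedge only and the new hyperedge contains the new hypervertex only. -/
theorem IsStrongPath.isLegalMove_iff {P : List (V × E)} (hP : H.IsStrongPath P) {q : V × E} :
    H.IsLegalMove P q ↔ H.Inc q.1 q.2 ∧ (∀ i (hi : i < P.length), ¬ H.Inc P[i].1 q.2) ∧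
      ∀ j (hj : j < P.length), (H.Inc q.1 P[j].2 ↔ P.length = j + 1) := by
  obtain ⟨-, h⟩ := isStrongPath_iff.1 hP
  rw [IsLegalMove, isStrongPath_iff]
  constructor
  · rintro ⟨-, h'⟩
    refine ⟨?_, fun i hi => ?_, fun j hj => ?_⟩
    · simpa using h' P.length (by simp) P.length (by simp)
    · have := h' i (by simp; omega) P.length (by simp)
      simp only [List.getElem_append_left hi, List.getElem_concat_length] at this
      rw [this]; omega
    · have := h' P.length (by simp) j (by simp; omega)
      simp only [List.getElem_append_left hj, List.getElem_concat_length] at this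
      rw [this]; omega
  · rintro ⟨h1, h2, h3⟩
    refine ⟨by simp, fun i hi j hj => ?_⟩
    rw [List.length_append, List.length_singleton] at hi hj
    rcases Nat.lt_succ_iff_lt_or_eq.1 hi with hi | rfl <;>
      rcases Nat.lt_succ_iff_lt_or_eq.1 hj with hj | rfl
    · simp only [List.getElem_append_left hi, List.getElem_append_left hj, h]
    · simp only [List.getElem_append_left hi, List.getElem_concat_length, h2 i hi, false_iff]
      omega
    · simp only [List.getElem_append_left hj, List.getElem_concat_length, h3 j hj]
      omega
    · simpa using h1

theorem IsStrongPath.length_le [Finite E] {P : List (V × E)} (hP : H.IsStrongPath P) :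
    P.length ≤ Nat.card E := by
  obtain ⟨-, h⟩ := isStrongPath_iff.1 hP
  rw [← Nat.card_fin P.length]
  refine Nat.card_le_card_of_injective (fun i => (P[i.val]'i.isLt).2) fun i j hij => ?_
  have h1 := (h i i.isLt i i.isLt).2 (.inl rfl)
  have h2 := (h j j.isLt j j.isLt).2 (.inl rfl)
  dsimp only at hij
  rw [hij, h i i.isLt j j.isLt] at h1
  rw [← hij, h j j.isLt i i.isLt] at h2
  ext; omega

theorem encard_le_one_image_iff {α β : Type*} {f : α → β} (hf : f.Injective) {N : Set β}
    {S : Set α} : (N ∩ f '' S).encard ≤ 1 ↔ ∀ a ∈ S, ∀ a' ∈ S, f a ∈ N → f a' ∈ N → a = a' := by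
  rw [Set.encard_le_one_iff]
  constructor
  · exact fun h a ha a' ha' hN hN' => hf (h _ _ ⟨hN, a, ha, rfl⟩ ⟨hN', a', ha', rfl⟩)
  · rintro h _ _ ⟨hN, a, ha, rfl⟩ ⟨hN', a', ha', rfl⟩
    rw [h a ha a' ha' hN hN']

theorem isMatching_iff {M : Set E} :
    H.IsMatching M ↔ ∀ v, ∀ e ∈ M, ∀ e' ∈ M, H.Inc v e → H.Inc v e' → e = e' := by
  simp only [IsMatching, Splits, Set.forall_mem_range,
    encard_le_one_image_iff Sum.inr_injective]
  exact Iff.rfl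

theorem isIndependent_iff {U : Set V} :
    H.IsIndependent U ↔ ∀ e, ∀ v ∈ U, ∀ v' ∈ U, H.Inc v e → H.Inc v' e → v = v' := by
  simp only [IsIndependent, Splits, Set.forall_mem_range,
    encard_le_one_image_iff Sum.inl_injective]
  exact Iff.rfl

theorem one_le_encard_image_iff {α β : Type*} {f : α → β} {N : Set β} {S : Set α} :
    1 ≤ (N ∩ f '' S).encard ↔ ∃ a ∈ S, f a ∈ N := by
  rw [Set.one_le_encard_iff_nonempty]
  constructor
  · rintro ⟨_, hN, a, ha, rfl⟩
    exact ⟨a, ha, hN⟩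
  · rintro ⟨a, ha, hN⟩
    exact ⟨_, hN, a, ha, rfl⟩

theorem isTransversal_iff {T : Set V} : H.IsTransversal T ↔ ∀ e, ∃ v ∈ T, H.Inc v e := by
  simp only [IsTransversal, Covers, Set.forall_mem_range, one_le_encard_image_iff]
  exact Iff.rfl

theorem covers_image_iff {M : Set E} {U : Set V} :
    H.Covers (Sum.inr '' M) (Sum.inl '' U) ↔ ∀ v ∈ U, ∃ e ∈ M, H.Inc v e := by
  simp only [Covers, Set.forall_mem_image, one_le_encard_image_iff]
  exact Iff.rfl

end IncHypergraph

/-! ### Replies of the two players -/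

namespace IncHypergraph

variable {V E : Type*}

section augment

variable {H : IncHypergraph V E} {U : Set V}

theorem augment_inc_old {x : AugVertex V} {e : E} :
    (H.augment U).Inc x (.old e) ↔ ∃ v, x = .old v ∧ H.Inc v e := by
  cases x <;> simp [augment]

theorem augment_inc_f {x : AugVertex V} {u : U} :
    (H.augment U).Inc x (.f u) ↔ x = .v₁ ∨ x = .old u := by
  cases x <;> simp [augment]

theorem augment_inc_e₀ {x : AugVertex V} :
    (H.augment U).Inc x .e₀ ↔ x = .v₀ ∨ x = .v₁ := by
  cases x <;> simp [augment]

instance [Finite V] [Finite E] : Finite (AugEdge E U) :=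
  Finite.of_surjective
    (fun o : Option (U ⊕ E) => match o with
      | none => .e₀
      | some (.inl u) => .f u
      | some (.inr e) => .old e)
    fun g => match g with
      | .e₀ => ⟨none, rfl⟩
      | .f u => ⟨some (.inl u), rfl⟩
      | .old e => ⟨some (.inr e), rfl⟩

/-- The reply of Player 2 to a play `x₀ g₀ … xₙ₋₁ gₙ₋₁`, given a matching `M` covering `U`. -/
theorem exists_reply_of_matching (hU : ∀ e, ∀ v ∈ U, ∀ v' ∈ U, H.Inc v e → H.Inc v' e → v = v')
    (hUt : ∀ e, ∃ v ∈ U, H.Inc v e) {M : Set E}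
    (hM : ∀ v, ∀ e ∈ M, ∀ e' ∈ M, H.Inc v e → H.Inc v e' → e = e')
    (hMU : ∀ v ∈ U, ∃ e ∈ M, H.Inc v e) {x : ℕ → AugVertex V} {g : ℕ → AugEdge E U} {n : ℕ}
    (h : ∀ i < n, ∀ j < n, ((H.augment U).Inc (x i) (g j) ↔ i = j ∨ i = j + 1))
    (hn : Even n) (hpos : 0 < n) (hx0 : x 0 = .v₀) (hg0 : g 0 = .e₀)
    (hmv : ∀ i < n, 2 ≤ i → Even i → ∃ u ∈ U, ∃ m ∈ M, x i = .old u ∧ g i = .old m) :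
    ∃ u ∈ U, ∃ m ∈ M, (H.augment U).Inc (.old u) (.old m) ∧
      (∀ i < n, ¬ (H.augment U).Inc (x i) (.old m)) ∧
      ∀ j < n, ((H.augment U).Inc (.old u) (g j) ↔ n = j + 1) := by
  obtain ⟨r, hr⟩ := hn
  have hex : ∀ g : AugEdge E U, g ≠ .e₀ → ∃ u ∈ U, (H.augment U).Inc (.old u) g := by
    rintro (_ | u | e) hg
    · exact absurd rfl hg
    · exact ⟨u, u.2, rfl⟩
    · exact hUt e
  have huniq : ∀ g : AugEdge E U, ∀ u ∈ U, ∀ u' ∈ U, (H.augment U).Inc (.old u) g →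
      (H.augment U).Inc (.old u') g → u = u' := by
    rintro (_ | w | e) u hu u' hu' h h'
    · exact h.elim
    · exact (show u = w from h).trans (show u' = w from h').symm
    · exact hU e u hu u' hu' h h'
  obtain ⟨u, hu, hug⟩ := hex (g (n - 1)) fun hg => by
    have := h 0 (by omega) (n - 1) (by omega)
    rw [hg, hx0, augment_inc_e₀] at this
    have := this.1 (.inl rfl)
    omega
  obtain ⟨m, hm, hum⟩ := hMU u hu
  have key : ∀ i < n, 2 ≤ i → Even i → ∃ u' ∈ U, ∃ m' ∈ M, x i = .old u' ∧ g i = .old m' ∧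
      u ≠ u' ∧ H.Inc u' m' := by
    intro i hi h2 hev
    obtain ⟨u', hu', m', hm', hxi, hgi⟩ := hmv i hi h2 hev
    refine ⟨u', hu', m', hm', hxi, hgi, ?_, ?_⟩
    · rintro rfl
      rw [← hxi, h i hi (n - 1) (by omega)] at hug
      obtain ⟨s, hs⟩ := hev
      omega
    · have := (h i hi i hi).2 (.inl rfl)
      rwa [hxi, hgi] at this
  -- Every later part of the path touches a move of Player 2: $x_i$ lies on $g_i$ or $g_{i-1}$,
  -- whichever belongs to $M$, and $g_j$ contains $x_j$ or $x_{j+1}$, whichever is the element of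
  -- $U$ chosen by Player 2.
  have hpar : ∀ i, 2 ≤ i → ∃ i', 2 ≤ i' ∧ Even i' ∧ (i = i' ∨ i = i' + 1) := fun i hi => by
    rcases Nat.even_or_odd i with hev | ⟨s, hs⟩
    · exact ⟨i, hi, hev, .inl rfl⟩
    · exact ⟨2 * s, by omega, even_two_mul s, .inr hs⟩
  refine ⟨u, hu, m, hm, hum, fun i hi him => ?_, fun j hj => ⟨fun huj => ?_, ?_⟩⟩
  · obtain ⟨v, hxv, hvm⟩ := augment_inc_old.1 him
    have hi2 : 2 ≤ i := by
      by_contra hlt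
      have := (h i hi 0 hpos).2 (by omega)
      rw [hg0, augment_inc_e₀, hxv] at this
      simp at this
    obtain ⟨i', hi', hev, hii⟩ := hpar i hi2
    obtain ⟨u', hu', m', hm', hxi, hgi, hne, hinc⟩ := key i' (by omega) hi' hev
    have hvm' := (h i hi i' (by omega)).2 hii
    rw [hxv, hgi] at hvm'
    obtain rfl := hM v m hm m' hm' hvm hvm'
    exact hne (hU m u hu u' hu' hum hinc)
  · by_contra hne
    have hj0 : j ≠ 0 := by
      rintro rfl
      rw [hg0, augment_inc_e₀] at huj
      simp at huj
    obtain ⟨i', hi', hev, hii⟩ := hpar (j + 1) (by omega)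
    obtain ⟨u', hu', m', hm', hxi, hgi, hne, hinc⟩ := key i' (by omega) hi' hev
    have := (h i' (by omega) j hj).2 (by omega)
    rw [hxi] at this
    exact hne (huniq _ u hu u' hu' huj this)
  · rintro rfl
    exact hug

/-- The reply of Player 1 to a play `x₀ g₀ … xₙ₋₁ gₙ₋₁` that went through an element `u₀` of `U`
missed by a matching `M`, given a transversal `T` complementary to `M`. -/
theorem exists_reply_of_transversal (hH : ¬ HasOddCycle H.Inc) {M : Set E} {T : Set V}
    (hM : ∀ v, ∀ e ∈ M, ∀ e' ∈ M, H.Inc v e → H.Inc v e' → e = e')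
    (hT : ∀ e, ∃ v ∈ T, H.Inc v e) (hTM : ∀ v ∈ T, ∃ e ∈ M, H.Inc v e)
    (hMT : ∀ e ∈ M, ∀ v ∈ T, ∀ v' ∈ T, H.Inc v e → H.Inc v' e → v = v')
    {u₀ : U} (hu₀ : ∀ e ∈ M, ¬ H.Inc u₀ e)
    {x : ℕ → AugVertex V} {g : ℕ → AugEdge E U} {n : ℕ}
    (h : ∀ i < n, ∀ j < n, ((H.augment U).Inc (x i) (g j) ↔ i = j ∨ i = j + 1))
    (hn : Odd n) (hlt : 1 < n) (hx0 : x 0 = .v₀) (hg0 : g 0 = .e₀)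
    (hx1 : x 1 = .v₁) (hg1 : g 1 = .f u₀)
    (hmv : ∀ i < n, 2 ≤ i → Odd i → ∃ t ∈ T, ∃ m ∈ M, x i = .old t ∧ g i = .old m) :
    ∃ t ∈ T, ∃ m ∈ M, (H.augment U).Inc (.old t) (.old m) ∧
      (∀ i < n, ¬ (H.augment U).Inc (x i) (.old m)) ∧
      ∀ j < n, ((H.augment U).Inc (.old t) (g j) ↔ n = j + 1) := by
  obtain ⟨r, hr⟩ := hn
  -- After the opening the play stays in `H`, because $e_0$ contains $v_0$ and every $f_u$ contains
  -- $v_1$.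
  have hgold : ∀ i, 2 ≤ i → i < n → ∃ e, g i = .old e := by
    intro i hi2 hi
    have h0 := h 0 (by omega) i hi
    have h1 := h 1 hlt i hi
    rw [hx0] at h0
    rw [hx1] at h1
    rcases hg : g i with _ | u | e
    · have := h0.1 (by rw [hg, augment_inc_e₀]; simp)
      omega
    · have := h1.1 (by rw [hg, augment_inc_f]; simp)
      omega
    · exact ⟨e, rfl⟩
  have hxold : ∀ i, 2 ≤ i → i < n → ∃ v, x i = .old v := by
    intro i hi2 hi
    obtain ⟨e, he⟩ := hgold i hi2 hi
    have := (h i hi i hi).2 (.inl rfl)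
    rw [he, augment_inc_old] at this
    exact this.imp fun v hv => hv.1
  obtain ⟨e, he⟩ := hgold (n - 1) (by omega) (by omega)
  obtain ⟨t, ht, hte⟩ := hT e
  obtain ⟨m, hm, htm⟩ := hTM t ht
  have htg : (H.augment U).Inc (.old t) (g (n - 1)) := by rw [he]; exact hte
  have htu : t ≠ u₀ := by
    rintro rfl
    exact hu₀ m hm htm
  have key : ∀ i < n, 2 ≤ i → Odd i → ∃ t' ∈ T, ∃ m' ∈ M, x i = .old t' ∧ g i = .old m' ∧
      t ≠ t' ∧ H.Inc t' m' := by
    intro i hi h2 hodd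
    obtain ⟨t', ht', m', hm', hxi, hgi⟩ := hmv i hi h2 hodd
    refine ⟨t', ht', m', hm', hxi, hgi, ?_, ?_⟩
    · rintro rfl
      rw [← hxi, h i hi (n - 1) (by omega)] at htg
      obtain ⟨s, hs⟩ := hodd
      omega
    · have := (h i hi i hi).2 (.inl rfl)
      rwa [hxi, hgi] at this
  have hnodd : ∀ j < n, 2 ≤ j → Odd j → ¬ (H.augment U).Inc (.old t) (g j) := by
    intro j hj h2 hodd htj
    obtain ⟨t', ht', m', hm', hxj, hgj, hne, hinc⟩ := key j hj h2 hodd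
    rw [hgj] at htj
    exact hne (hMT m' hm' t ht t' ht' htj hinc)
  -- Take the last hyperedge $g_j$ of Player 2 before $g_{n-1}$ that contains `t`. Then
  -- $t\,g_j\,x_{j+1}\ldots x_{n-1}\,g_{n-1}$ closes to a strong cycle with $d=n-j$ hyperedges, and
  -- $d$ is odd.
  have hneven : ∀ d j, j + d = n → 1 < d → 2 ≤ j → Even j →
      ¬ (H.augment U).Inc (.old t) (g j) := by
    intro d
    induction d using Nat.strong_induction_on with
    | _ d ih =>
    intro j hjd hd hj2 hev htj
    obtain ⟨s, hs⟩ := hev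
    obtain ⟨k, rfl⟩ : ∃ k, d = 2 * k + 1 := ⟨r - s, by omega⟩
    have hbelow : ∀ i, j < i → i + 1 < n → ¬ (H.augment U).Inc (.old t) (g i) := by
      intro i hji hi
      rcases Nat.even_or_odd i with hev | hodd
      · exact ih (n - i) (by omega) i (by omega) (by omega) (by omega) hev
      · exact hnodd i (by omega) (by omega) hodd
    have : Nonempty V := ⟨t⟩
    have : Nonempty E := ⟨e⟩
    choose! v hv using hxold
    choose! e he using hgold
    refine hH ⟨k, fun i => if i = 0 then t else v (j + i), fun i => e (j + i), by omega,
      fun a ha b hb => ?_⟩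
    change (H.augment U).Inc (.old (if a = 0 then t else v (j + a))) (.old (e (j + b))) ↔ _
    rw [← he (j + b) (by omega) (by omega)]
    split_ifs with ha0
    · by_cases hb0 : b = 0
      · simp [ha0, hb0, htj]
      · by_cases hbk : b = 2 * k
        · rw [show j + b = n - 1 by omega]
          exact iff_of_true htg (by omega)
        · exact iff_of_false (hbelow _ (by omega) (by omega)) (by omega)
    · rw [← hv (j + a) (by omega) (by omega), h _ (by omega) _ (by omega)]
      omega
  refine ⟨t, ht, m, hm, htm, fun i hi him => ?_, fun j hj => ⟨fun htj => ?_, ?_⟩⟩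
  · obtain ⟨v, hxv, hvm⟩ := augment_inc_old.1 him
    have hi2 : 2 ≤ i := by
      by_contra hlt
      have := (h i hi 0 (by omega)).2 (by omega)
      rw [hg0, augment_inc_e₀, hxv] at this
      simp at this
    -- $x_2$ can only be $u_0$, which `M` misses; each later $x_i$ lies on a hyperedge of `M` chosen
    -- by Player 1.
    rcases eq_or_lt_of_le hi2 with rfl | hi2
    · have := (h 2 hi 1 hlt).2 (by omega)
      rw [hg1, augment_inc_f, hxv] at this
      simp only [reduceCtorEq, AugVertex.old.injEq, false_or] at this
      exact hu₀ m hm (this ▸ hvm)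
    · obtain ⟨i', hi', hodd, hii⟩ : ∃ i', 2 ≤ i' ∧ Odd i' ∧ (i = i' ∨ i = i' + 1) := by
        rcases Nat.even_or_odd' i with ⟨s, hs | hs⟩
        · exact ⟨i - 1, by omega, ⟨s - 1, by omega⟩, by omega⟩
        · exact ⟨i, by omega, ⟨s, hs⟩, .inl rfl⟩
      obtain ⟨t', ht', m', hm', hxi, hgi, hne, hinc⟩ := key i' (by omega) hi' hodd
      have hvm' := (h i hi i' (by omega)).2 hii
      rw [hxv, hgi] at hvm'
      obtain rfl := hM v m hm m' hm' hvm hvm'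
      exact hne (hMT m hm t ht t' ht' htm hinc)
  · by_contra hne
    rcases Nat.lt_or_ge j 2 with hj2 | hj2
    · interval_cases j
      · rw [hg0, augment_inc_e₀] at htj
        simp at htj
      · rw [hg1, augment_inc_f] at htj
        simp [htu] at htj
    · rcases Nat.even_or_odd j with hev | hodd
      · exact hneven (n - j) j (by omega) (by omega) hj2 hev htj
      · exact hnodd j hj hj2 hodd htj
  · rintro rfl
    exact htg

end augment

/-! ### From replies to strategies -/

theorem IsStrongPath.inc_getD_iff {H : IncHypergraph V E} {P : List (V × E)}
    (hP : H.IsStrongPath P) (d : V × E) :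
    ∀ i < P.length, ∀ j < P.length, (H.Inc (P.getD i d).1 (P.getD j d).2 ↔ i = j ∨ i = j + 1) := by
  intro i hi j hj
  rw [List.getD_eq_getElem _ _ hi, List.getD_eq_getElem _ _ hj]
  exact (isStrongPath_iff.1 hP).2 i hi j hj

theorem IsStrongPath.isLegalMove_of_getD {H : IncHypergraph V E} {P : List (V × E)}
    (hP : H.IsStrongPath P) {q : V × E} (d : V × E) (h : H.Inc q.1 q.2)
    (hx : ∀ i < P.length, ¬ H.Inc (P.getD i d).1 q.2)
    (hg : ∀ j < P.length, (H.Inc q.1 (P.getD j d).2 ↔ P.length = j + 1)) : H.IsLegalMove P q := by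
  refine hP.isLegalMove_iff.2 ⟨h, fun i hi => ?_, fun j hj => ?_⟩
  · rw [← List.getD_eq_getElem _ d hi]; exact hx i hi
  · rw [← List.getD_eq_getElem _ d hj]; exact hg j hj

theorem isTurn_two_iff {P : List (V × E)} : IsTurn 2 P ↔ Even P.length := by
  rw [IsTurn, Nat.even_iff, Nat.ModEq]

theorem isStrongPath_start {H : IncHypergraph V E} {U : Set V} :
    (H.augment U).IsStrongPath [(.v₀, .e₀)] := by
  refine isStrongPath_iff.2 ⟨by simp, fun i hi j hj => ?_⟩
  rw [List.length_singleton, Nat.lt_one_iff] at hi hj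
  subst hi hj
  simp [augment]

theorem hasWinningStrategy_of_matching {H : IncHypergraph V E} {U : Set V}
    (hU : ∀ e, ∀ v ∈ U, ∀ v' ∈ U, H.Inc v e → H.Inc v' e → v = v')
    (hUt : ∀ e, ∃ v ∈ U, H.Inc v e) {M : Set E}
    (hM : ∀ v, ∀ e ∈ M, ∀ e' ∈ M, H.Inc v e → H.Inc v e' → e = e')
    (hMU : ∀ v ∈ U, ∃ e ∈ M, H.Inc v e) :
    (H.augment U).HasWinningStrategy .v₀ .e₀ 2 := by
  classical
  let d : AugVertex V × AugEdge E U := (.v₀, .e₀)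
  let Good (q : AugVertex V × AugEdge E U) : Prop := ∃ u ∈ U, ∃ m ∈ M, q = (.old u, .old m)
  let Inv (P : List (AugVertex V × AugEdge E U)) : Prop := (H.augment U).IsStrongPath P ∧
    0 < P.length ∧ P.getD 0 d = d ∧ ∀ i < P.length, 2 ≤ i → Even i → Good (P.getD i d)
  have hreply : ∀ P, Inv P → Even P.length → ∃ q, (H.augment U).IsLegalMove P q ∧ Good q := by
    rintro P ⟨hP, hpos, h0, hmv⟩ hev
    obtain ⟨u, hu, m, hm, h1, h2, h3⟩ := exists_reply_of_matching hU hUt hM hMU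
      (hP.inc_getD_iff d) hev hpos (congrArg Prod.fst h0) (congrArg Prod.snd h0)
      fun i hi h2 hev => by
        obtain ⟨u, hu, m, hm, h⟩ := hmv i hi h2 hev
        exact ⟨u, hu, m, hm, congrArg Prod.fst h, congrArg Prod.snd h⟩
    exact ⟨(.old u, .old m), hP.isLegalMove_of_getD d h1 h2 h3, u, hu, m, hm, rfl⟩
  -- A strategy must be legal at every list, also at those no play reaches; hence the fallback to an
  -- arbitrary legal move.
  let mv (P : List (AugVertex V × AugEdge E U)) : AugVertex V × AugEdge E U :=
    if h : ∃ q, (H.augment U).IsLegalMove P q ∧ Good q then h.choose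
    else if h : ∃ q, (H.augment U).IsLegalMove P q then h.choose else d
  have hmvGood : ∀ P, (∃ q, (H.augment U).IsLegalMove P q ∧ Good q) →
      (H.augment U).IsLegalMove P (mv P) ∧ Good (mv P) := fun P h => by
    simp only [mv, dif_pos h]
    exact h.choose_spec
  let σ : (H.augment U).Strategy 2 :=
    { move := mv
      legal := fun P _ h => by
        by_cases h' : ∃ q, (H.augment U).IsLegalMove P q ∧ Good q
        · exact (hmvGood P h').1
        · simp only [mv, dif_neg h', dif_pos h]
          exact h.choose_spec }
  have hstep : ∀ P q, Inv P → (H.augment U).IsLegalMove P q → (Even P.length → Good q) →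
      Inv (P ++ [q]) := by
    rintro P q ⟨hP, hpos, h0, hmv⟩ hq hgood
    refine ⟨hq, by simp, by rw [List.getD_append _ _ _ _ hpos, h0], fun i hi h2 hev => ?_⟩
    rw [List.length_append, List.length_singleton] at hi
    rcases Nat.lt_succ_iff_lt_or_eq.1 hi with hi | rfl
    · rw [List.getD_append _ _ _ _ hi]
      exact hmv i hi h2 hev
    · rw [List.getD_append_right _ _ _ _ le_rfl]
      simpa using hgood hev
  have hinv : ∀ P, σ.Play .v₀ .e₀ P → Inv P := by
    intro P hP
    induction hP with
    | start =>
      refine ⟨isStrongPath_start, by simp, rfl, fun i hi h2 => ?_⟩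
      rw [List.length_singleton] at hi
      omega
    | own _ hturn hlegal ih =>
      exact hstep _ _ ih hlegal fun hev => (hmvGood _ (hreply _ ih hev)).2
    | other _ hturn hlegal ih =>
      exact hstep _ _ ih hlegal fun hev => absurd (isTurn_two_iff.2 hev) hturn
  refine ⟨σ, fun P hP hstuck hturn => hstuck ?_⟩
  obtain ⟨q, hq, -⟩ := hreply P (hinv P hP) (isTurn_two_iff.1 hturn)
  exact ⟨q, hq⟩

/-- Against a winning strategy of Player 2 the replies of Player 1 would prolong the play forever,
whereas a strong path has at most as many pairs as there are hyperedges. -/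
theorem not_hasWinningStrategy_of_transversal [Finite V] [Finite E] {H : IncHypergraph V E}
    {U : Set V} (hH : ¬ HasOddCycle H.Inc) {M : Set E} {T : Set V}
    (hM : ∀ v, ∀ e ∈ M, ∀ e' ∈ M, H.Inc v e → H.Inc v e' → e = e')
    (hT : ∀ e, ∃ v ∈ T, H.Inc v e) (hTM : ∀ v ∈ T, ∃ e ∈ M, H.Inc v e)
    (hMT : ∀ e ∈ M, ∀ v ∈ T, ∀ v' ∈ T, H.Inc v e → H.Inc v' e → v = v')
    {u₀ : U} (hu₀ : ∀ e ∈ M, ¬ H.Inc u₀ e) :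
    ¬ (H.augment U).HasWinningStrategy .v₀ .e₀ 2 := by
  rintro ⟨σ, hσ⟩
  let d : AugVertex V × AugEdge E U := (.v₀, .e₀)
  let Good (i : ℕ) (q : AugVertex V × AugEdge E U) : Prop :=
    (i = 1 → q = (.v₁, .f u₀)) ∧ (2 ≤ i → ∃ t ∈ T, ∃ m ∈ M, q = (.old t, .old m))
  let Inv (P : List (AugVertex V × AugEdge E U)) : Prop := (H.augment U).IsStrongPath P ∧
    0 < P.length ∧ P.getD 0 d = d ∧ ∀ i < P.length, Odd i → Good i (P.getD i d)
  have hreply : ∀ P, Inv P → Odd P.length →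
      ∃ q, (H.augment U).IsLegalMove P q ∧ Good P.length q := by
    rintro P ⟨hP, hpos, h0, hmv⟩ hodd
    rcases Nat.lt_or_ge 1 P.length with hlt | hle
    · have h1 := (hmv 1 hlt odd_one).1 rfl
      obtain ⟨t, ht, m, hm, h1, h2, h3⟩ := exists_reply_of_transversal hH hM hT hTM hMT hu₀
        (hP.inc_getD_iff d) hodd hlt (congrArg Prod.fst h0) (congrArg Prod.snd h0)
        (congrArg Prod.fst h1) (congrArg Prod.snd h1)
        fun i hi h2 hodd => by
          obtain ⟨t, ht, m, hm, h⟩ := (hmv i hi hodd).2 h2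
          exact ⟨t, ht, m, hm, congrArg Prod.fst h, congrArg Prod.snd h⟩
      exact ⟨(.old t, .old m), hP.isLegalMove_of_getD d h1 h2 h3, fun h => absurd h hlt.ne',
        fun _ => ⟨t, ht, m, hm, rfl⟩⟩
    · have hlen : P.length = 1 := by omega
      refine ⟨(.v₁, .f u₀), hP.isLegalMove_of_getD d trivial (fun i hi => ?_) (fun j hj => ?_),
        fun _ => rfl, fun h2 => by omega⟩
      · obtain rfl : i = 0 := by omega
        rw [h0, augment_inc_f]
        simp [d]
      · obtain rfl : j = 0 := by omega
        rw [h0, augment_inc_e₀]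
        simp [hlen]
  have hstep : ∀ P q, Inv P → (H.augment U).IsLegalMove P q → (Odd P.length → Good P.length q) →
      Inv (P ++ [q]) := by
    rintro P q ⟨hP, hpos, h0, hmv⟩ hq hgood
    refine ⟨hq, by simp, by rw [List.getD_append _ _ _ _ hpos, h0], fun i hi hodd => ?_⟩
    rw [List.length_append, List.length_singleton] at hi
    rcases Nat.lt_succ_iff_lt_or_eq.1 hi with hi | rfl
    · rw [List.getD_append _ _ _ _ hi]
      exact hmv i hi hodd
    · rw [List.getD_append_right _ _ _ _ le_rfl]
      simpa using hgood hodd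
  have hlong : ∀ k, ∃ P, σ.Play .v₀ .e₀ P ∧ P.length = 2 * k + 1 ∧ Inv P := by
    intro k
    induction k with
    | zero =>
      refine ⟨_, .start, rfl, isStrongPath_start, by simp, rfl, fun i hi hodd => ?_⟩
      rw [List.length_singleton, Nat.lt_one_iff] at hi
      subst hi
      simp at hodd
    | succ k ih =>
      obtain ⟨P, hP, hlen, hinv⟩ := ih
      have hodd : Odd P.length := ⟨k, hlen⟩
      obtain ⟨q, hq, hgood⟩ := hreply P hinv hodd
      have hplay : σ.Play .v₀ .e₀ (P ++ [q]) :=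
        .other hP (by rwa [isTurn_two_iff, Nat.not_even_iff_odd]) hq
      have hinv' := hstep P q hinv hq fun _ => hgood
      have hev : Even (P ++ [q]).length := by
        rw [List.length_append, List.length_singleton]
        exact hodd.add_one
      have hturn := isTurn_two_iff.2 hev
      have hlegal := σ.legal _ hturn (by
        by_contra hstuck
        exact hσ _ hplay hstuck hturn)
      refine ⟨_, .own hplay hturn hlegal, by simp [hlen]; ring, hstep _ _ hinv' hlegal fun h => ?_⟩
      exact absurd hev (Nat.not_even_iff_odd.2 h)
  obtain ⟨P, -, hlen, hP, -⟩ := hlong (Nat.card (AugEdge E U))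
  have := hP.length_le
  omega

end IncHypergraph

theorem theorem4 {V E : Type*} [Finite V] [Finite E] (H : IncHypergraph V E) (hH : H.Balanced)
    (U : Set V) (hind : H.IsIndependent U) (htr : H.IsTransversal U) :
    (∃ M : Set E, H.IsMatching M ∧ H.Covers (Sum.inr '' M) (Sum.inl '' U)) ↔
      (H.augment U).HasWinningStrategy IncHypergraph.AugVertex.v₀ IncHypergraph.AugEdge.e₀ 2 := by
  simp only [IncHypergraph.isMatching_iff, IncHypergraph.covers_image_iff]
  rw [IncHypergraph.isIndependent_iff] at hind
  rw [IncHypergraph.isTransversal_iff] at htr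
  constructor
  · rintro ⟨M, hM, hMU⟩
    exact IncHypergraph.hasWinningStrategy_of_matching hind htr hM hMU
  · intro hwin
    by_contra! hcon
    -- Hyperedges are nonempty because `U` is a transversal.
    obtain ⟨M, T, hM, hT, hTM, hMT⟩ := exists_matching_transversal_slack hH.not_hasOddCycle
      fun e => (htr e).imp fun v hv => hv.2
    obtain ⟨u, hu, huM⟩ := hcon M hM
    exact IncHypergraph.not_hasWinningStrategy_of_transversal (u₀ := ⟨u, hu⟩)
      hH.not_hasOddCycle hM hT hTM hMT huM hwin
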